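/- All graphs are finite and simple. A dominating set of a graph $G$ is a set $D \subseteq V(G)$ such that every vertex of $V(G) \setminus D$ is adjacent to at least one vertex of $D$. The TARS-graph $\varepsilon(G)$ has the dominating sets of $G$ as its vertices; two of them, $X$ and $Y$, are adjacent if and only if either $Y$ is obtained from $X$ by adding or deleting a single vertex of $G$, or there are vertices $a \in X$ and $b \in Y \setminus X$ that are adjacent in $G$ and satisfy $Y = (X \cup \{b\}) \setminus \{a\}$. A graph on $n$ vertices is pancyclic if it contains a cycle of length $\ell$ for every integer $\ell$ with $3 \le \ell \le n$. For a graph $H$ with distinct vertices $u$, $v$, $x$ such that $N(u) = \{x, v\}$ and $N(v) = \{u\}$, the graph $H' = H - \{u, v\}$ is said to be obtained from $H$ by Operation A. **Corollary (Operation A without connectedness).** Let $H$ and $H'$ be graphs such that $H'$ is obtained from $H$ by Operation A; $H'$ is not required to be connected or to have at least two vertices. If $\varepsilon(H')$ is pancyclic, then $\varepsilon(H)$ is also pancyclic. -/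

import Mathlib

namespace TARS

/-- `D` is a dominating set of `G`: every vertex outside `D` is adjacent to a vertex of `D`. -/
def IsDominating {V : Type*} (G : SimpleGraph V) (D : Set V) : Prop :=
  ∀ w, w ∉ D → ∃ d ∈ D, G.Adj w d

/-- Token addition/removal: `Y` is obtained from `X` by adding or deleting a single vertex. -/
def TARStep {V : Type*} (X Y : Set V) : Prop :=
  (∃ w, w ∉ X ∧ Y = X ∪ {w}) ∨ (∃ w, w ∈ X ∧ Y = X \ {w})

/-- Token sliding: `Y = (X ∪ {b}) \ {a}` for adjacent vertices `a ∈ X` and `b ∈ Y \ X`. -/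
def TSStep {V : Type*} (G : SimpleGraph V) (X Y : Set V) : Prop :=
  ∃ a ∈ X, ∃ b ∈ Y \ X, G.Adj a b ∧ Y = (X ∪ {b}) \ {a}

theorem TARStep.symm {V : Type*} {X Y : Set V} (h : TARStep X Y) : TARStep Y X := by
  rcases h with ⟨w, hw, rfl⟩ | ⟨w, hw, rfl⟩
  · refine Or.inr ⟨w, by simp, ?_⟩
    ext z
    by_cases hz : z = w
    · subst hz; simp [hw]
    · simp [hz]
  · refine Or.inl ⟨w, by simp, ?_⟩
    ext z
    by_cases hz : z = w
    · subst hz; simp [hw]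
    · simp [hz]

theorem TSStep.symm {V : Type*} {G : SimpleGraph V} {X Y : Set V} (h : TSStep G X Y) :
    TSStep G Y X := by
  obtain ⟨a, ha, b, ⟨hbY, hbX⟩, hab, hY⟩ := h
  refine ⟨b, hbY, a, ⟨ha, by simp [hY]⟩, hab.symm, ?_⟩
  ext z
  by_cases hza : z = a
  · subst hza; simp [ha, hab.ne]
  · by_cases hzb : z = b
    · subst hzb; simp [hbX]
    · simp [hY, hza, hzb]

theorem not_TARStep_self {V : Type*} (X : Set V) : ¬ TARStep X X := by
  rintro (⟨w, hw, h⟩ | ⟨w, hw, h⟩)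
  · exact hw (h ▸ (by simp : w ∈ X ∪ {w}))
  · rw [h] at hw; exact hw.2 rfl

theorem not_TSStep_self {V : Type*} (G : SimpleGraph V) (X : Set V) : ¬ TSStep G X X := by
  rintro ⟨a, _, b, hb, _⟩
  exact hb.2 hb.1

/-- The TARS-graph of `G`: its vertices are the dominating sets of `G`, and two of them are
adjacent if and only if they differ by a token addition/removal or by a token slide. -/
def tarsGraph {V : Type*} (G : SimpleGraph V) : SimpleGraph {D : Set V // IsDominating G D} where
  Adj X Y := TARStep X.1 Y.1 ∨ TSStep G X.1 Y.1
  symm := ⟨fun _ _ h => h.imp TARStep.symm TSStep.symm⟩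
  loopless := ⟨fun X h => h.elim (not_TARStep_self X.1) (not_TSStep_self G X.1)⟩

/-- A finite graph on `n` vertices is pancyclic if it contains a cycle of every length `ℓ` with
`3 ≤ ℓ ≤ n`. -/
def IsPancyclic {W : Type*} [Finite W] (G : SimpleGraph W) : Prop :=
  ∀ ℓ : ℕ, 3 ≤ ℓ → ℓ ≤ Nat.card W → ∃ (w : W) (c : G.Walk w w), c.IsCycle ∧ c.length = ℓ

/-- `H'` is obtained from `H` by Operation A: there are distinct vertices `u`, `v`, `x` of `H` with
`N(u) = {x, v}` and `N(v) = {u}`, and `H'` is (isomorphic to) `H - {u, v}`, the subgraph of `H`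
induced by all vertices other than `u` and `v`. -/
def IsOperationA {V V' : Type*} (H : SimpleGraph V) (H' : SimpleGraph V') : Prop :=
  ∃ u v x : V, u ≠ v ∧ u ≠ x ∧ v ≠ x ∧ H.neighborSet u = {x, v} ∧ H.neighborSet v = {u} ∧
    Nonempty (H' ≃g H.induce ({u, v}ᶜ : Set V))

end TARS

/-! Send a dominating set `X` of `H` to its trace on `V(H')`, adding `x` if the trace is not
dominating; `x` is then the only undominated vertex. The fibre (column) over `a` consists of `a ∪
{u}`, `a ∪ {u, v}`, `a ∪ {v}` and, when `a` is critical, also `(a \ {x}) ∪ {u}` and `(a \ {x}) ∪ {u,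
v}`. Edges of `ε(H')` lift to the `R` levels and to the `M` level (`step_lift`).

Pancyclicity of `ε(H')` is used only for a Hamiltonian path (`exists_hamiltonian_path`). Go out
along this path on the `R` levels, spending 2, 3 or 5 vertices in each column, and return on the `M`
level. Since `R b a` and `M a` are adjacent, this closes into a cycle. Induction along the path
(`hasPath_of_isPath`) gives every length up to the total column size, except total minus one when
all columns have five vertices; `exists_isCycle_of_forall` supplies that length through the extra
edge from `M` to `D true`. -/

namespace TARS

open SimpleGraph

/-! ### Cycles in a graph fibred into columns over a graph with a Hamiltonian path. -/

section Columns

variable {A W : Type*}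

/-- A graph `Γ` whose vertex set is partitioned into columns indexed by the vertices of `G`. The
column of `a` is a triangle `R false a`, `R true a`, `M a`, and, when `S a` holds, has two further
vertices `D false a`, `D true a`. -/
structure ColumnCover (G : SimpleGraph A) (Γ : SimpleGraph W) (S : A → Prop) where
  col : W → A
  R : Bool → A → W
  M : A → W
  D : Bool → ∀ a, S a → W
  col_R : ∀ b a, col (R b a) = a
  col_M : ∀ a, col (M a) = a
  col_D : ∀ b a hs, col (D b a hs) = a
  adj_RR : ∀ b a, Γ.Adj (R b a) (R (!b) a)
  adj_RM : ∀ b a, Γ.Adj (R b a) (M a)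
  adj_RD : ∀ b a hs, Γ.Adj (R b a) (D b a hs)
  adj_DD : ∀ b a hs, Γ.Adj (D b a hs) (D (!b) a hs)
  adj_MD : ∀ a hs, Γ.Adj (M a) (D true a hs)
  adj_lift_R : ∀ b a a', G.Adj a a' → Γ.Adj (R b a) (R b a')
  adj_lift_M : ∀ a a', G.Adj a a' → Γ.Adj (M a) (M a')
  R_ne_D : ∀ b b' a hs, R b a ≠ D b' a hs
  M_ne_D : ∀ b a hs, M a ≠ D b a hs
  cover : ∀ w, (∃ b, w = R b (col w)) ∨ w = M (col w) ∨ ∃ b hs, w = D b (col w) hs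

open Classical in
/-- The number of vertices in the column of `a`. -/
noncomputable def columnSize (S : A → Prop) (a : A) : ℕ := if S a then 5 else 3

theorem exists_isCycle_of_isPath {Γ : SimpleGraph W} {x y : W} (p : Γ.Walk x y) (hp : p.IsPath)
    (hl : 2 ≤ p.length) (h : Γ.Adj y x) :
    ∃ (w : W) (c : Γ.Walk w w), c.IsCycle ∧ c.length = p.length + 1 := by
  refine ⟨y, Walk.cons h p, ?_, by simp⟩
  rw [Walk.cons_isCycle_iff]
  refine ⟨hp, fun he => ?_⟩
  cases p with
  | nil => simp at hl
  | @cons _ z _ h' q =>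
    rw [Walk.cons_isPath_iff] at hp
    rw [Walk.edges_cons, List.mem_cons] at he
    rcases he with he | he
    · have hz : z = y := by
        rw [Sym2.eq_iff] at he
        rcases he with ⟨h1, h2⟩ | ⟨h1, h2⟩
        · exact absurd h1 h.ne
        · exact h1.symm
      subst hz
      have : q = Walk.nil := Walk.eq_nil_iff_nil.2 (Walk.isPath_iff_nil.1 hp.1)
      subst this
      simp at hl
    · exact hp.2 (Walk.snd_mem_support_of_mem_edges q he)

namespace ColumnCover

variable {G : SimpleGraph A} {Γ : SimpleGraph W} {S : A → Prop} (C : ColumnCover G Γ S)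

/-- There is a path with `k` vertices from `R b a` to `M a` inside the columns indexed by `l`. -/
def HasPath (l : List A) (a : A) (k : ℕ) : Prop :=
  ∀ b, ∃ p : Γ.Walk (C.R b a) (C.M a), p.IsPath ∧ p.length + 1 = k ∧ ∀ w ∈ p.support, C.col w ∈ l

theorem hasPath_two {l : List A} {a : A} (ha : a ∈ l) : C.HasPath l a 2 := fun b =>
  ⟨.cons (C.adj_RM b a) .nil, by simp [(C.adj_RM b a).ne], by simp, by
    simp [C.col_R, C.col_M, ha]⟩

theorem hasPath_three {l : List A} {a : A} (ha : a ∈ l) : C.HasPath l a 3 := fun b =>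
  ⟨.cons (C.adj_RR b a) (.cons (C.adj_RM (!b) a) .nil),
    by simp [(C.adj_RM b a).ne, (C.adj_RR b a).ne, (C.adj_RM (!b) a).ne], by simp, by
    simp [C.col_R, C.col_M, ha]⟩

theorem adj_DR (b : Bool) (a : A) (hs : S a) : Γ.Adj (C.D (!b) a hs) (C.R (!b) a) :=
  (C.adj_RD (!b) a hs).symm

theorem hasPath_five {l : List A} {a : A} (ha : a ∈ l) (hs : S a) : C.HasPath l a 5 := fun b =>
  ⟨.cons (C.adj_RD b a hs) (.cons (C.adj_DD b a hs) (.cons (C.adj_DR b a hs)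
    (.cons (C.adj_RM (!b) a) .nil))),
    by simp [(C.adj_RM b a).ne, (C.adj_RR b a).ne, (C.adj_RM (!b) a).ne, (C.adj_DD b a hs).ne,
      C.R_ne_D, (C.R_ne_D _ _ _ _).symm, (C.M_ne_D _ _ _).symm], by simp, by
    simp [C.col_R, C.col_M, C.col_D, ha]⟩

section Step

variable {l : List A} {a a' : A} {k : ℕ}

/-- Go out from `R b a` and return to `M a`. The old path avoids the column of `a` because `a ∉ l`.
-/
theorem hasPath_add_two (h : G.Adj a a') (ha : a ∉ l) (hk : C.HasPath l a' k) :
    C.HasPath (a :: l) a (k + 2) := by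
  intro b
  obtain ⟨p, hp, hl, hc⟩ := hk b
  have hn : ∀ w, C.col w = a → w ∉ p.support := fun w hw hm => ha (hw ▸ hc w hm)
  refine ⟨.cons (C.adj_lift_R b a a' h) (p.concat (C.adj_lift_M a' a h.symm)), ?_, ?_, ?_⟩
  · rw [Walk.cons_isPath_iff]
    refine ⟨hp.concat (hn _ (C.col_M a)) _, ?_⟩
    simp [Walk.support_concat, hn _ (C.col_R b a), (C.adj_RM b a).ne]
  · simp; omega
  · intro w hw
    simp only [Walk.support_cons, Walk.support_concat, List.mem_cons,
      List.mem_append, List.not_mem_nil, or_false] at hw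
    rcases hw with rfl | hw | rfl
    · simp [C.col_R]
    · exact List.mem_cons_of_mem _ (hc w hw)
    · simp [C.col_M]

/-- Crossing to `R (!b) a` before leaving the column costs one more vertex. The next column is then
entered at the opposite level, which is why `HasPath` quantifies over both values of `b`. -/
theorem hasPath_add_three (h : G.Adj a a') (ha : a ∉ l) (hk : C.HasPath l a' k) :
    C.HasPath (a :: l) a (k + 3) := by
  intro b
  obtain ⟨p, hp, hl, hc⟩ := hk (!b)
  have hn : ∀ w, C.col w = a → w ∉ p.support := fun w hw hm => ha (hw ▸ hc w hm)
  refine ⟨.cons (C.adj_RR b a) (.cons (C.adj_lift_R (!b) a a' h)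
    (p.concat (C.adj_lift_M a' a h.symm))), ?_, ?_, ?_⟩
  · simp only [Walk.cons_isPath_iff]
    refine ⟨⟨hp.concat (hn _ (C.col_M a)) _, ?_⟩, ?_⟩ <;>
    simp [Walk.support_concat, hn _ (C.col_R _ a), (C.adj_RM _ a).ne, (C.adj_RR b a).ne]
  · simp; omega
  · intro w hw
    simp only [Walk.support_cons, Walk.support_concat, List.mem_cons,
      List.mem_append, List.not_mem_nil, or_false] at hw
    rcases hw with rfl | rfl | hw | rfl
    · simp [C.col_R]
    · simp [C.col_R]
    · exact List.mem_cons_of_mem _ (hc w hw)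
    · simp [C.col_M]

/-- The crossing to `R (!b) a` now detours through both `D` vertices, so the whole column is used.
-/
theorem hasPath_add_five (h : G.Adj a a') (ha : a ∉ l) (hs : S a) (hk : C.HasPath l a' k) :
    C.HasPath (a :: l) a (k + 5) := by
  intro b
  obtain ⟨p, hp, hl, hc⟩ := hk (!b)
  have hn : ∀ w, C.col w = a → w ∉ p.support := fun w hw hm => ha (hw ▸ hc w hm)
  refine ⟨.cons (C.adj_RD b a hs) (.cons (C.adj_DD b a hs) (.cons (C.adj_DR b a hs)
    (.cons (C.adj_lift_R (!b) a a' h) (p.concat (C.adj_lift_M a' a h.symm))))), ?_, ?_, ?_⟩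
  · simp only [Walk.cons_isPath_iff]
    refine ⟨⟨⟨⟨hp.concat (hn _ (C.col_M a)) _, ?_⟩, ?_⟩, ?_⟩, ?_⟩ <;>
    simp [Walk.support_concat, hn _ (C.col_R _ a), hn _ (C.col_D _ a hs), (C.adj_RM _ a).ne,
      (C.adj_RR b a).ne, (C.adj_DD b a hs).ne, C.R_ne_D, (C.R_ne_D _ _ _ _).symm,
      (C.M_ne_D _ _ _).symm]
  · simp; omega
  · intro w hw
    simp only [Walk.support_cons, Walk.support_concat, List.mem_cons,
      List.mem_append, List.not_mem_nil, or_false] at hw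
    rcases hw with rfl | rfl | rfl | rfl | hw | rfl
    · simp [C.col_R]
    · simp [C.col_D]
    · simp [C.col_D]
    · simp [C.col_R]
    · exact List.mem_cons_of_mem _ (hc w hw)
    · simp [C.col_M]

end Step

theorem columnSize_of_mem {S : A → Prop} {a : A} (hs : S a) : columnSize S a = 5 := if_pos hs

theorem columnSize_of_not {S : A → Prop} {a : A} (hs : ¬ S a) : columnSize S a = 3 := if_neg hs

theorem three_le_columnSize (S : A → Prop) (a : A) : 3 ≤ columnSize S a := by
  unfold columnSize; split_ifs <;> omega

/-- The excluded value comes from a single five-vertex column, where the building blocks have 2, 3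
or 5 vertices but never 4. Any three-vertex column on the path removes the exception. -/
theorem hasPath_of_isPath {a a' : A} (p : G.Walk a a') (hp : p.IsPath) (k : ℕ) (hk : 2 ≤ k)
    (hk' : k ≤ (p.support.map (columnSize S)).sum)
    (hS : k + 1 = (p.support.map (columnSize S)).sum → ∃ c ∈ p.support, ¬ S c) :
    C.HasPath p.support a k := by
  induction p generalizing k with
  | @nil a =>
    simp only [Walk.support_nil, List.map_cons, List.map_nil, List.sum_cons, List.sum_nil,
      add_zero, List.mem_singleton, exists_eq_left] at hk' hS ⊢
    have ha : a ∈ [a] := by simp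
    by_cases hs : S a
    · rw [columnSize_of_mem hs] at hk' hS
      have h4 : k ≠ 4 := fun h => hS (by omega) hs
      obtain rfl | rfl | rfl : k = 2 ∨ k = 3 ∨ k = 5 := by omega
      exacts [C.hasPath_two ha, C.hasPath_three ha, C.hasPath_five ha hs]
    · rw [columnSize_of_not hs] at hk'
      obtain rfl | rfl : k = 2 ∨ k = 3 := by omega
      exacts [C.hasPath_two ha, C.hasPath_three ha]
  | @cons a b c h p ih =>
    rw [Walk.cons_isPath_iff] at hp
    specialize ih hp.1
    simp only [Walk.support_cons, List.map_cons, List.sum_cons, List.mem_cons,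
      exists_eq_or_imp] at hk' hS ⊢
    have hm : 3 ≤ (p.support.map (columnSize S)).sum := by
      rw [← Walk.cons_tail_support]
      have := three_le_columnSize S b
      simp only [List.map_cons, List.sum_cons]; omega
    -- A remainder of total size 3 is one small column, so the value 2, one below its total, is not
    -- exceptional there.
    have hthree : (p.support.map (columnSize S)).sum = 3 → ∃ c ∈ p.support, ¬ S c := by
      intro h3
      by_contra! hall
      have h5 := columnSize_of_mem (hall b p.start_mem_support)
      rw [← Walk.cons_tail_support] at h3
      simp only [List.map_cons, List.sum_cons] at h3
      omega
    generalize (p.support.map (columnSize S)).sum = m at *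
    have h2 : ∀ j, 2 ≤ j → j ≤ m → (j + 1 = m → ∃ c ∈ p.support, ¬ S c) → k = j + 2 →
        C.HasPath (a :: p.support) a k := by
      rintro j h1 h2 h3 rfl
      exact C.hasPath_add_two h hp.2 (ih j h1 h2 h3)
    have h3 : ∀ j, 2 ≤ j → j ≤ m → (j + 1 = m → ∃ c ∈ p.support, ¬ S c) → k = j + 3 →
        C.HasPath (a :: p.support) a k := by
      rintro j h1 h4 h3 rfl
      exact C.hasPath_add_three h hp.2 (ih j h1 h4 h3)
    have ha : a ∈ a :: p.support := by simp
    by_cases k2 : k = 2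
    · subst k2; exact C.hasPath_two ha
    by_cases k3 : k = 3
    · subst k3; exact C.hasPath_three ha
    -- The increment is chosen so that the remaining count differs from the possibly exceptional `m
    -- - 1`. This fails only for `k = m + 1` with `m = 3`, covered by `hthree`, and for `k = m + 4`,
    -- where `hS` provides a small column in the remainder.
    by_cases km : k ≤ m
    · exact h2 (k - 2) (by omega) (by omega) (by omega) (by omega)
    by_cases k1 : k = m + 1
    · by_cases m3 : m = 3
      · exact h2 2 (by omega) (by omega) (fun _ => hthree m3) (by omega)
      · exact h3 (m - 2) (by omega) (by omega) (by omega) (by omega)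
    by_cases k2 : k = m + 2
    · exact h2 m (by omega) (by omega) (by omega) (by omega)
    by_cases k3 : k = m + 3
    · exact h3 m (by omega) (by omega) (by omega) (by omega)
    by_cases hs : S a
    · rw [columnSize_of_mem hs] at hk' hS
      obtain ⟨j, rfl⟩ : ∃ j, k = j + 5 := ⟨k - 5, by omega⟩
      refine C.hasPath_add_five h hp.2 hs (ih j (by omega) (by omega) fun hj => ?_)
      rcases hS (by omega) with h | h
      · exact absurd hs h
      · exact h
    · rw [columnSize_of_not hs] at hk'
      omega

/-- The cycle that misses exactly one vertex when every column has five vertices. -/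
theorem exists_isCycle_of_forall (C : ColumnCover G Γ S) {a a' : A} (p : G.Walk a a') (hp : p.IsPath)
    (hS : ∀ c ∈ p.support, S c) :
    ∃ (w : W) (c : Γ.Walk w w), c.IsCycle ∧
      c.length + 1 = (p.support.map (columnSize S)).sum := by
  have hs : S a := hS a p.start_mem_support
  have hMD := C.adj_MD a hs
  have hDD := C.adj_DD true a hs
  have hDR := C.adj_DR true a hs
  -- The path `q` will use only `R false a` and `M a` from the first column and everything in the
  -- others. Closing it through `D true a` and `D false a` leaves out just `R true a`.
  suffices h : ∃ q : Γ.Walk (C.R false a) (C.M a), q.IsPath ∧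
      q.length + 4 = (p.support.map (columnSize S)).sum ∧
      (∀ b, C.D b a hs ∉ q.support) by
    obtain ⟨q, hq, hl, hD⟩ := h
    have hq' : ((q.concat hMD).concat hDD).IsPath := by
      refine (hq.concat (hD _) _).concat ?_ _
      simp only [Walk.support_concat, List.mem_append, List.mem_singleton,
        not_or]
      exact ⟨hD _, hDD.ne.symm⟩
    obtain ⟨w, c, hc, hc'⟩ := exists_isCycle_of_isPath _ hq' (by simp) hDR
    refine ⟨w, c, hc, ?_⟩
    simp only [Walk.length_concat] at hc'
    omega
  cases p with
  | nil =>
    refine ⟨.cons (C.adj_RM false a) .nil, by simp [(C.adj_RM false a).ne], ?_, ?_⟩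
    · simp [columnSize_of_mem hs]
    · simp [(C.R_ne_D _ _ _ _).symm, (C.M_ne_D _ _ _).symm]
  | @cons _ b _ h p =>
    rw [Walk.cons_isPath_iff] at hp
    have hb : 3 ≤ (p.support.map (columnSize S)).sum := by
      rw [← Walk.cons_tail_support]
      have := three_le_columnSize S b
      simp only [List.map_cons, List.sum_cons]; omega
    obtain ⟨q, hq, hl, hc⟩ := C.hasPath_of_isPath p hp.1 _ (by omega) le_rfl (by omega) false
    have hn : ∀ w, C.col w = a → w ∉ q.support := fun w hw hm => hp.2 (hw ▸ hc w hm)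
    refine ⟨.cons (C.adj_lift_R false a b h) (q.concat (C.adj_lift_M b a h.symm)), ?_, ?_, ?_⟩
    · rw [Walk.cons_isPath_iff]
      refine ⟨hq.concat (hn _ (C.col_M a)) _, ?_⟩
      simp [Walk.support_concat, hn _ (C.col_R false a), (C.adj_RM false a).ne]
    · simp [columnSize_of_mem hs]; omega
    · intro b'
      simp [Walk.support_concat, hn _ (C.col_D b' a hs), (C.R_ne_D _ _ _ _).symm,
        (C.M_ne_D _ _ _).symm]

theorem card_fiber_le [Fintype W] [DecidableEq A] (a : A) :
    (Finset.univ.filter fun w => C.col w = a).card ≤ columnSize S a := by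
  classical
  by_cases hs : S a
  · rw [columnSize_of_mem hs]
    refine (Finset.card_le_card (t := {C.R false a, C.R true a, C.M a, C.D false a hs,
      C.D true a hs}) ?_).trans Finset.card_le_five
    intro w hw
    obtain rfl : C.col w = a := by simpa using hw
    rcases C.cover w with ⟨b, h⟩ | h | ⟨b, hs, h⟩
    · cases b <;> simp [← h]
    · simp [← h]
    · cases b <;> simp [← h]
  · rw [columnSize_of_not hs]
    refine (Finset.card_le_card (t := {C.R false a, C.R true a, C.M a}) ?_).trans
      Finset.card_le_three
    intro w hw
    obtain rfl : C.col w = a := by simpa using hw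
    rcases C.cover w with ⟨b, h⟩ | h | ⟨b, hs', h⟩
    · cases b <;> simp [← h]
    · simp [← h]
    · exact absurd hs' hs

/-- Only this upper bound on the number of vertices is needed: constructing cycles of all lengths up
to the total column size then suffices. -/
theorem card_le (C : ColumnCover G Γ S) [Finite W] {a a' : A} (p : G.Walk a a') (hp : p.IsPath)
    (hall : ∀ c, c ∈ p.support) : Nat.card W ≤ (p.support.map (columnSize S)).sum := by
  classical
  have := Fintype.ofFinite W
  rw [Nat.card_eq_fintype_card, ← Finset.card_univ,
    ← List.sum_toFinset _ hp.support_nodup,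
    Finset.card_eq_sum_card_fiberwise (f := C.col) (t := p.support.toFinset) (by
      intro w _; simp [hall])]
  exact Finset.sum_le_sum fun a _ => C.card_fiber_le a

end ColumnCover

theorem ColumnCover.isPancyclic {G : SimpleGraph A} {Γ : SimpleGraph W} {S : A → Prop}
    (C : ColumnCover G Γ S) [Finite W] {a a' : A} (p : G.Walk a a') (hp : p.IsPath)
    (hall : ∀ c, c ∈ p.support) : IsPancyclic Γ := by
  intro k hk hk'
  have hle := hk'.trans (C.card_le p hp hall)
  by_cases hS : k + 1 = (p.support.map (columnSize S)).sum → ∃ c ∈ p.support, ¬ S c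
  · obtain ⟨q, hq, hl, -⟩ := C.hasPath_of_isPath p hp k (by omega) hle hS false
    obtain ⟨w, c, hc, hcl⟩ := exists_isCycle_of_isPath q hq (by omega) (C.adj_RM false a).symm
    exact ⟨w, c, hc, by omega⟩
  · push Not at hS
    obtain ⟨w, c, hc, hcl⟩ := C.exists_isCycle_of_forall p hp hS.2
    exact ⟨w, c, hc, by omega⟩

end Columns

/-! ### A Hamiltonian path in the TARS-graph of a smaller graph. -/

section HamiltonianPath

variable {V : Type*}

theorem IsDominating.mono {G : SimpleGraph V} {X Y : Set V} (h : IsDominating G X) (hXY : X ⊆ Y) :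
    IsDominating G Y := fun w hw =>
  let ⟨d, hd, hwd⟩ := h w fun hx => hw (hXY hx)
  ⟨d, hXY hd, hwd⟩

theorem mem_support_of_isPath_of_card_le {W : Type*} [Finite W] {G : SimpleGraph W} {a b : W}
    (p : G.Walk a b) (hp : p.IsPath) (h : Nat.card W ≤ p.length + 1) (c : W) : c ∈ p.support := by
  classical
  have := Fintype.ofFinite W
  have hc : p.support.toFinset = Finset.univ := by
    apply Finset.eq_univ_of_card
    apply le_antisymm (Finset.card_le_univ _)
    rw [List.toFinset_card_of_nodup hp.support_nodup, Walk.length_support,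
      ← Nat.card_eq_fintype_card]
    exact h
  have := Finset.mem_univ c
  rwa [← hc, List.mem_toFinset] at this

/-- Removing an edge from a Hamiltonian cycle leaves the path. With fewer than three dominating sets
pancyclicity is vacuous, and the path has one vertex or is the edge from the full set to the full
set minus a vertex. -/
theorem exists_hamiltonian_path [Finite V] (G : SimpleGraph V) (h : IsPancyclic (tarsGraph G)) :
    ∃ (a b : _) (p : (tarsGraph G).Walk a b), p.IsPath ∧ ∀ c, c ∈ p.support := by
  let top : {D : Set V // IsDominating G D} := ⟨Set.univ, fun w hw => absurd trivial hw⟩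
  by_cases h3 : 3 ≤ Nat.card {D : Set V // IsDominating G D}
  · obtain ⟨w, c, hc, hl⟩ := h _ h3 le_rfl
    cases c with
    | nil => simp at hl; omega
    | cons hadj p =>
      rw [Walk.cons_isCycle_iff] at hc
      simp only [Walk.length_cons] at hl
      exact ⟨_, _, p, hc.1, mem_support_of_isPath_of_card_le p hc.1 (by omega)⟩
  by_cases hT : ∀ X, X = top
  · exact ⟨top, top, .nil, by simp, by simpa using hT⟩
  push Not at hT
  obtain ⟨X, hX⟩ := hT
  obtain ⟨z, hz⟩ : ∃ z, z ∉ X.1 := by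
    by_contra! hall
    exact hX (Subtype.ext (Set.eq_univ_of_forall hall))
  have hadj : (tarsGraph G).Adj top ⟨Set.univ \ {z}, X.2.mono fun y hy =>
      ⟨trivial, fun e => hz (e ▸ hy)⟩⟩ := Or.inl (Or.inr ⟨z, trivial, rfl⟩)
  have hp : (Walk.cons hadj .nil).IsPath := by simp [hadj.ne]
  refine ⟨_, _, _, hp, mem_support_of_isPath_of_card_le _ hp ?_⟩
  simp; omega

end HamiltonianPath

/-! ### The columns of `ε(H)` over `ε(H')` under Operation A. -/

section OperationA

variable {V V' : Type*}

/-- `φ` embeds `H'` into `H` as the subgraph induced by all vertices other than `u` and `v`, where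
`N(u) = {φ x, v}` and `N(v) = {u}`. -/
structure OperationAData (H : SimpleGraph V) (H' : SimpleGraph V') where
  u : V
  v : V
  x : V'
  φ : V' → V
  inj : Function.Injective φ
  ne : u ≠ v
  adj : ∀ a b, H.Adj (φ a) (φ b) ↔ H'.Adj a b
  φ_ne_u : ∀ a, φ a ≠ u
  φ_ne_v : ∀ a, φ a ≠ v
  range : ∀ z, z = u ∨ z = v ∨ ∃ y, z = φ y
  adj_u : ∀ z, H.Adj u z ↔ z = φ x ∨ z = v
  adj_v : ∀ z, H.Adj v z ↔ z = u

theorem IsOperationA.nonempty_data {H : SimpleGraph V} {H' : SimpleGraph V'}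
    (h : IsOperationA H H') : Nonempty (OperationAData H H') := by
  obtain ⟨u, v, x, huv, hux, hvx, hu, hv, ⟨e⟩⟩ := h
  have hx : x ∈ ({u, v}ᶜ : Set V) := by simp [hux.symm, hvx.symm]
  refine ⟨⟨u, v, e.symm ⟨x, hx⟩, fun a => (e a).1, fun a b hab => e.injective (Subtype.ext hab),
    huv, fun a b => e.map_adj_iff, fun a ha => (e a).2 (by simp [ha]),
    fun a ha => (e a).2 (by simp [ha]), fun z => ?_, fun z => ?_, fun z => ?_⟩⟩
  · by_cases hz : z ∈ ({u, v}ᶜ : Set V)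
    · exact Or.inr (Or.inr ⟨e.symm ⟨z, hz⟩, by simp⟩)
    · have : z = u ∨ z = v := by simpa using Set.notMem_compl_iff.1 hz
      tauto
  · rw [← SimpleGraph.mem_neighborSet, hu]; simp
  · rw [← SimpleGraph.mem_neighborSet, hv]; simp

namespace OperationAData

variable {H : SimpleGraph V} {H' : SimpleGraph V'} (d : OperationAData H H')

/-- Every vertex other than `x` is in `X` or has a neighbour in `X`. -/
def AlmostDominating (X : Set V') : Prop := ∀ w, w ∉ X → w ≠ d.x → ∃ y ∈ X, H'.Adj w y

theorem isDominating_v {X : Set V'} (h : IsDominating H' X) :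
    IsDominating H (d.φ '' X ∪ {d.v}) := by
  intro w hw
  rcases d.range w with rfl | rfl | ⟨y, rfl⟩
  · exact ⟨d.v, by simp, by simp [d.adj_u]⟩
  · simp at hw
  · obtain ⟨z, hz, hyz⟩ := h y fun hy => hw (Or.inl ⟨y, hy, rfl⟩)
    exact ⟨d.φ z, Or.inl ⟨z, hz, rfl⟩, (d.adj _ _).2 hyz⟩

theorem isDominating_u {X : Set V'} (h : d.AlmostDominating X) {t : Set V} (ht : d.u ∈ t) :
    IsDominating H (d.φ '' X ∪ t) := by
  intro w hw
  rcases d.range w with rfl | rfl | ⟨y, rfl⟩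
  · exact absurd (Or.inr ht) hw
  · exact ⟨d.u, Or.inr ht, by simp [d.adj_v]⟩
  · by_cases hx : y = d.x
    · subst hx
      exact ⟨d.u, Or.inr ht, ((d.adj_u _).2 (Or.inl rfl)).symm⟩
    obtain ⟨z, hz, hyz⟩ := h y (fun hy => hw (Or.inl ⟨y, hy, rfl⟩)) hx
    exact ⟨d.φ z, Or.inl ⟨z, hz, rfl⟩, (d.adj _ _).2 hyz⟩

theorem almostDominating_of_isDominating {X : Set V'} (h : IsDominating H' X) :
    d.AlmostDominating X := fun w hw _ => h w hw

/-- Outside `V(H')`, only `u` can dominate a vertex of `H'`, and that vertex must be `x`. -/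
theorem almostDominating_preimage {X : Set V} (h : IsDominating H X) :
    d.AlmostDominating (d.φ ⁻¹' X) := by
  intro w hw hx
  obtain ⟨z, hz, hwz⟩ := h (d.φ w) hw
  rcases d.range z with rfl | rfl | ⟨y, rfl⟩
  · rcases (d.adj_u _).1 hwz.symm with h | h
    · exact absurd (d.inj h) hx
    · exact absurd h (d.φ_ne_v w)
  · exact absurd ((d.adj_v _).1 hwz.symm) (d.φ_ne_u w)
  · exact ⟨y, hz, (d.adj _ _).1 hwz⟩

theorem isDominating_preimage_of_notMem {X : Set V} (h : IsDominating H X) (hu : d.u ∉ X) :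
    IsDominating H' (d.φ ⁻¹' X) := by
  intro w hw
  obtain ⟨z, hz, hwz⟩ := h (d.φ w) hw
  rcases d.range z with rfl | rfl | ⟨y, rfl⟩
  · exact absurd hz hu
  · exact absurd ((d.adj_v _).1 hwz.symm) (d.φ_ne_u w)
  · exact ⟨y, hz, (d.adj _ _).1 hwz⟩

theorem v_mem_of_u_notMem {X : Set V} (h : IsDominating H X) (hu : d.u ∉ X) : d.v ∈ X := by
  by_contra hv
  obtain ⟨z, hz, hvz⟩ := h _ hv
  exact hu ((d.adj_v _).1 hvz ▸ hz)

theorem AlmostDominating.union {X : Set V'} (h : d.AlmostDominating X) :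
    IsDominating H' (X ∪ {d.x}) := by
  intro w hw
  simp only [Set.mem_union, Set.mem_singleton_iff, not_or] at hw
  obtain ⟨y, hy, hwy⟩ := h w hw.1 hw.2
  exact ⟨y, Or.inl hy, hwy⟩

theorem AlmostDominating.isDominating {X : Set V'} (h : d.AlmostDominating X) (hx : d.x ∈ X) :
    IsDominating H' X := fun w hw => h w hw fun e => hw (e ▸ hx)

/-- A fixed set `t` of tokens outside `V(H')` does not interfere with a move inside `H'`. -/
theorem step_lift {X Y : Set V'} (t : Set V) (ht : ∀ a, d.φ a ∉ t)
    (h : TARStep X Y ∨ TSStep H' X Y) :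
    TARStep (d.φ '' X ∪ t) (d.φ '' Y ∪ t) ∨ TSStep H (d.φ '' X ∪ t) (d.φ '' Y ∪ t) := by
  have hmem : ∀ (Z : Set V') a, d.φ a ∈ d.φ '' Z ∪ t ↔ a ∈ Z := fun Z a => by
    simp [ht, d.inj.eq_iff]
  have hdiff : ∀ (Z : Set V') a, d.φ '' (Z \ {a}) ∪ t = (d.φ '' Z ∪ t) \ {d.φ a} := fun Z a => by
    rw [Set.image_sdiff d.inj, Set.union_sdiff_distrib, Set.image_singleton]
    congr 1
    refine (Set.sdiff_singleton_eq_self (ht a)).symm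
  have hunion : ∀ (Z : Set V') a, d.φ '' (Z ∪ {a}) ∪ t = (d.φ '' Z ∪ t) ∪ {d.φ a} := fun Z a => by
    rw [Set.image_union, Set.image_singleton, Set.union_right_comm]
  rcases h with (⟨w, hw, rfl⟩ | ⟨w, hw, rfl⟩) | ⟨a, ha, b, ⟨hb, hb'⟩, hab, hY⟩
  · exact Or.inl (Or.inl ⟨d.φ w, by rwa [hmem], hunion _ _⟩)
  · exact Or.inl (Or.inr ⟨d.φ w, by rwa [hmem], hdiff _ _⟩)
  · refine Or.inr ⟨d.φ a, by rwa [hmem], d.φ b, ⟨by rwa [hmem], by rwa [hmem]⟩,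
      (d.adj _ _).2 hab, ?_⟩
    rw [hY, hdiff, hunion]

/-- The dominating sets of `H'` from which deleting `x` leaves exactly `x` undominated. -/
def Critical (a : {D : Set V' // IsDominating H' D}) : Prop :=
  d.x ∈ a.1 ∧ ¬ IsDominating H' (a.1 \ {d.x}) ∧ d.AlmostDominating (a.1 \ {d.x})

/-- The set `{u, v}` or `{u}`. -/
def tail (b : Bool) : Set V := {z | z = d.u ∨ (b = true ∧ z = d.v)}

theorem u_mem_tail (b : Bool) : d.u ∈ d.tail b := Or.inl rfl

theorem φ_notMem_tail (b : Bool) (a : V') : d.φ a ∉ d.tail b := by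
  simp [tail, d.φ_ne_u, d.φ_ne_v]

theorem preimage_lift (X : Set V') (t : Set V) (ht : ∀ a, d.φ a ∉ t) :
    d.φ ⁻¹' (d.φ '' X ∪ t) = X := by
  ext a; simp [ht, d.inj.eq_iff]

open Classical in
/-- The dominating set of `H'` in whose column a dominating set of `H` lies. -/
noncomputable def col (X : {D : Set V // IsDominating H D}) : {D : Set V' // IsDominating H' D} :=
  if h : IsDominating H' (d.φ ⁻¹' X.1) then ⟨_, h⟩
  else ⟨_, (d.almostDominating_preimage X.2).union⟩

theorem col_eq (X : {D : Set V // IsDominating H D}) (a : {D : Set V' // IsDominating H' D})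
    (h : d.φ ⁻¹' X.1 = a.1) : d.col X = a := by
  have : IsDominating H' (d.φ ⁻¹' X.1) := h ▸ a.2
  rw [col, dif_pos this]
  exact Subtype.ext h

theorem col_eq_of_critical (X : {D : Set V // IsDominating H D})
    (a : {D : Set V' // IsDominating H' D}) (hs : d.Critical a)
    (h : d.φ ⁻¹' X.1 = a.1 \ {d.x}) : d.col X = a := by
  have : ¬ IsDominating H' (d.φ ⁻¹' X.1) := h ▸ hs.2.1
  rw [col, dif_neg this]
  apply Subtype.ext
  simp only [h]
  exact Set.sdiff_union_of_subset (by simpa using hs.1)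

theorem tail_true : d.tail true = d.tail false ∪ {d.v} := by
  ext z; simp [tail, or_comm]

theorem v_notMem_image (X : Set V') : d.v ∉ d.φ '' X := by
  rintro ⟨a, -, h⟩; exact d.φ_ne_v a h

theorem u_notMem_image (X : Set V') : d.u ∉ d.φ '' X := by
  rintro ⟨a, -, h⟩; exact d.φ_ne_u a h

theorem TARStep_tail (X : Set V') (b : Bool) :
    TARStep (d.φ '' X ∪ d.tail b) (d.φ '' X ∪ d.tail (!b)) := by
  have h : TARStep (d.φ '' X ∪ d.tail false) (d.φ '' X ∪ d.tail true) := by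
    refine Or.inl ⟨d.v, ?_, ?_⟩
    · have := d.v_notMem_image X
      simp [tail, d.ne.symm, this]
    · rw [tail_true, Set.union_assoc]
  cases b
  · exact h
  · exact h.symm

theorem eq_lift_tail {X : Set V} (hu : d.u ∈ X) : ∃ b, X = d.φ '' (d.φ ⁻¹' X) ∪ d.tail b := by
  classical
  refine ⟨decide (d.v ∈ X), ?_⟩
  ext z
  rcases d.range z with rfl | rfl | ⟨y, rfl⟩
  · simp [hu, tail]
  · simp [tail, d.ne.symm, d.φ_ne_v]
  · have := d.φ_notMem_tail (decide (d.v ∈ X)) y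
    simp [this, d.inj.eq_iff]

theorem eq_lift_v {X : Set V} (hu : d.u ∉ X) (hv : d.v ∈ X) :
    X = d.φ '' (d.φ ⁻¹' X) ∪ {d.v} := by
  ext z
  rcases d.range z with rfl | rfl | ⟨y, rfl⟩
  · simp [hu, d.ne, d.φ_ne_u]
  · simp [hv]
  · simp [d.φ_ne_v, d.inj.eq_iff]

theorem φ_notMem_v (a : V') : d.φ a ∉ ({d.v} : Set V) := d.φ_ne_v a

/-- The columns of the TARS-graph of `H` over the TARS-graph of `H'`. -/
noncomputable def columnCover : ColumnCover (tarsGraph H') (tarsGraph H) d.Critical where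
  col := d.col
  R b a := ⟨d.φ '' a.1 ∪ d.tail b,
    d.isDominating_u (d.almostDominating_of_isDominating a.2) (d.u_mem_tail b)⟩
  M a := ⟨d.φ '' a.1 ∪ {d.v}, d.isDominating_v a.2⟩
  D b a hs := ⟨d.φ '' (a.1 \ {d.x}) ∪ d.tail b, d.isDominating_u hs.2.2 (d.u_mem_tail b)⟩
  col_R b a := d.col_eq _ _ (d.preimage_lift _ _ (d.φ_notMem_tail b))
  col_M a := d.col_eq _ _ (d.preimage_lift _ _ d.φ_notMem_v)
  col_D b a hs := d.col_eq_of_critical _ _ hs (d.preimage_lift _ _ (d.φ_notMem_tail b))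
  adj_RR b a := Or.inl (d.TARStep_tail _ b)
  adj_RM b a := by
    have hu : d.u ∉ d.φ '' a.1 ∪ {d.v} := by
      have := d.u_notMem_image a.1
      simp only [Set.mem_union, Set.mem_singleton_iff, this, d.ne, or_self, not_false_eq_true]
    have hv : d.v ∉ d.φ '' a.1 := d.v_notMem_image a.1
    apply SimpleGraph.Adj.symm
    cases b
    -- Between `a ∪ {v}` and `a ∪ {u}` the token slides along the edge `vu`; for `b = true` the
    -- token `u` is simply added.
    · refine Or.inr ⟨d.v, by simp, d.u, ⟨Or.inr (d.u_mem_tail _), hu⟩, (d.adj_v _).2 rfl, ?_⟩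
      ext z
      by_cases hz : z = d.v
      · subst hz; simp [tail, d.ne.symm, hv]
      · simp [tail, hz, or_comm]
    · refine Or.inl (Or.inl ⟨d.u, hu, ?_⟩)
      ext z
      simp only [tail, Set.mem_union, Set.mem_singleton_iff, Set.mem_ofPred_eq, true_and]
      rw [or_right_comm, or_assoc]
  adj_RD b a hs := d.step_lift _ (d.φ_notMem_tail b) (Or.inl (Or.inr ⟨d.x, hs.1, rfl⟩))
  adj_DD b a hs := Or.inl (d.TARStep_tail _ b)
  adj_MD a hs := by
    apply SimpleGraph.Adj.symm
    -- Sliding the token from `u` to `x` turns `(a \ {x}) ∪ {u, v}` into `a ∪ {v}`.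
    refine Or.inr ⟨d.u, Or.inr (d.u_mem_tail _), d.φ d.x, ⟨Or.inl ⟨_, hs.1, rfl⟩, ?_⟩,
      (d.adj_u _).2 (Or.inl rfl), ?_⟩
    · have := d.φ_notMem_tail true d.x
      simp [this, d.inj.eq_iff]
    · ext z
      rcases d.range z with rfl | rfl | ⟨y, rfl⟩
      · simp [d.ne, d.φ_ne_u]
      · simp [tail, d.ne.symm]
      · have h1 := d.φ_notMem_tail true y
        have h2 := hs.1
        by_cases hy : y = d.x
        · subst hy; simp [h2, d.φ_ne_u, d.inj.eq_iff]
        · simp [hy, h1, d.φ_ne_u, d.φ_ne_v, d.inj.eq_iff]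
  adj_lift_R b a a' h := d.step_lift _ (d.φ_notMem_tail b) h
  adj_lift_M a a' h := d.step_lift _ d.φ_notMem_v h
  R_ne_D b b' a hs h := by
    have h' := congrArg (fun X => d.φ ⁻¹' X.1) h
    simp only [d.preimage_lift _ _ (d.φ_notMem_tail _)] at h'
    have := hs.1
    rw [h'] at this
    exact this.2 rfl
  M_ne_D b a hs h := by
    have h' := congrArg (fun X => d.φ ⁻¹' X.1) h
    simp only [d.preimage_lift _ _ (d.φ_notMem_tail _), d.preimage_lift _ _ d.φ_notMem_v] at h'
    have := hs.1
    rw [h'] at this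
    exact this.2 rfl
  cover X := by
    by_cases hP : IsDominating H' (d.φ ⁻¹' X.1)
    · have hc : d.col X = ⟨_, hP⟩ := d.col_eq X _ rfl
      rw [hc]
      by_cases hu : d.u ∈ X.1
      · obtain ⟨b, hb⟩ := d.eq_lift_tail hu
        exact Or.inl ⟨b, Subtype.ext hb⟩
      · exact Or.inr (Or.inl (Subtype.ext (d.eq_lift_v hu (d.v_mem_of_u_notMem X.2 hu))))
    · have hal := d.almostDominating_preimage X.2
      have hx : d.x ∉ d.φ ⁻¹' X.1 := fun hx => hP (hal.isDominating d hx)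
      -- If the trace is not dominating, `u` must be the vertex that dominates `x`, so `X` is one of
      -- the two `D` vertices of its column.
      have hu : d.u ∈ X.1 := by
        by_contra hu
        exact hP (d.isDominating_preimage_of_notMem X.2 hu)
      have hc : (d.col X).1 = d.φ ⁻¹' X.1 ∪ {d.x} := by rw [col, dif_neg hP]
      have hd : (d.col X).1 \ {d.x} = d.φ ⁻¹' X.1 := by
        rw [hc, Set.union_sdiff_right, Set.sdiff_singleton_eq_self hx]
      obtain ⟨b, hb⟩ := d.eq_lift_tail hu
      refine Or.inr (Or.inr ⟨b, ⟨by simp [hc], by rwa [hd], by rwa [hd]⟩, Subtype.ext ?_⟩)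
      simp only [hd]
      exact hb

end OperationAData

end OperationA

end TARS

theorem mainTheorem11 {V V' : Type*} [Finite V] [Finite V']
    (H : SimpleGraph V) (H' : SimpleGraph V') (hA : TARS.IsOperationA H H')
    (hH' : TARS.IsPancyclic (TARS.tarsGraph H')) :
    TARS.IsPancyclic (TARS.tarsGraph H) := by
  obtain ⟨d⟩ := hA.nonempty_data
  obtain ⟨a, b, p, hp, hall⟩ := TARS.exists_hamiltonian_path H' hH'
  exact d.columnCover.isPancyclic p hp hall
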